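/- Let $G=\{(a,b,c)\in\mathbb R^3\}$ be the Heisenberg group, where $(a,b,c)$ stands for the matrix $\begin{pmatrix}1&a&c\\0&1&b\\0&0&1\end{pmatrix}$, let $H\subset G$ be the subgroup of matrices with integer entries, and let $M=H\backslash G=\{Hg\mid g\in G\}$ be the Heisenberg 3D nil-manifold with projection $\pi:G\to M$, $\pi(g)=Hg$. In the coordinates $x=a$, $y=b$, $z=c-\frac{ab}{2}$ on $G$ consider the left-invariant sub-Riemannian structure with orthonormal frame $X_1=\partial_x-\frac y2\,\partial_z$, $X_2=\partial_y+\frac x2\,\partial_z$; let $d$ be its sub-Riemannian distance on $G$ (the infimum of the lengths $\int_0^{T}\sqrt{u_1^2+u_2^2}\,dt$ of the Lipschitz curves with $\dot g=u_1X_1(g)+u_2X_2(g)$ for almost all $t\in[0,T]$ connecting two given points), and let $d'$ be the distance on $M$ of the projected structure with orthonormal frame $\pi_*X_1,\pi_*X_2$. For $t\ge 0$ put $B_t=\{g\in G\mid d(\mathrm{Id},g)\le t\}$, $B'_t=\{q\in M\mid d'(\pi(\mathrm{Id}),q)\le t\}$, and let $$\bar t=\inf\{t>0\mid B'_t=M\}.$$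 Let $\tilde g=(1,0,0)$ and $\bar g=(\tfrac12,\tfrac12,\tfrac12)$ in the coordinates $(a,b,c)$. **Theorem.** We have $\bar t\ge d(\tilde g,\bar g)$. Moreover, $\bar g\notin H B_t$ for every $0\le t<d(\tilde g,\bar g)$; also $d(\tilde g,\bar g)<1$, and in fact $0.91<d(\tilde g,\bar g)<0.92$. -/

import Mathlib

open scoped ENNReal Pointwise

noncomputable section

/-- The Heisenberg group `G` in the coordinates `(a, b, c)`; the element `(a, b, c)` stands for the
unitriangular matrix `Heis.toMatrix`. -/
@[ext]
structure Heis where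
  a : ℝ
  b : ℝ
  c : ℝ

namespace Heis

/-- The matrix represented by `(a, b, c)`. -/
def toMatrix (g : Heis) : Matrix (Fin 3) (Fin 3) ℝ :=
  !![1, g.a, g.c; 0, 1, g.b; 0, 0, 1]

instance : Mul Heis := ⟨fun g h => ⟨g.a + h.a, g.b + h.b, g.c + h.c + g.a * h.b⟩⟩
instance : One Heis := ⟨⟨0, 0, 0⟩⟩
instance : Inv Heis := ⟨fun g => ⟨-g.a, -g.b, -g.c + g.a * g.b⟩⟩

@[simp] theorem mul_a (g h : Heis) : (g * h).a = g.a + h.a := rfl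
@[simp] theorem mul_b (g h : Heis) : (g * h).b = g.b + h.b := rfl
@[simp] theorem mul_c (g h : Heis) : (g * h).c = g.c + h.c + g.a * h.b := rfl
@[simp] theorem one_a : (1 : Heis).a = 0 := rfl
@[simp] theorem one_b : (1 : Heis).b = 0 := rfl
@[simp] theorem one_c : (1 : Heis).c = 0 := rfl
@[simp] theorem inv_a (g : Heis) : (g⁻¹).a = -g.a := rfl
@[simp] theorem inv_b (g : Heis) : (g⁻¹).b = -g.b := rfl
@[simp] theorem inv_c (g : Heis) : (g⁻¹).c = -g.c + g.a * g.b := rfl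

instance : Group Heis where
  mul_assoc g h k := by ext <;> simp <;> ring
  one_mul g := by ext <;> simp
  mul_one g := by ext <;> simp
  inv_mul_cancel g := by ext <;> simp

/-- The group law is matrix multiplication. -/
theorem toMatrix_mul (g h : Heis) : (g * h).toMatrix = g.toMatrix * h.toMatrix := by
  ext i j
  fin_cases i <;> fin_cases j <;>
    simp [toMatrix, Matrix.mul_apply, Fin.sum_univ_three] <;> ring

theorem toMatrix_one : (1 : Heis).toMatrix = 1 := by
  ext i j
  fin_cases i <;> fin_cases j <;> simp [toMatrix]

/-- The coordinates `(x, y, z)` on `G`, related to `(a, b, c)` by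
`a = x`, `b = y`, `c = z + x y / 2`. -/
def xyz (g : Heis) : ℝ × ℝ × ℝ := (g.a, g.b, g.c - g.a * g.b / 2)

/-- The left-invariant field `X₁ = ∂/∂x - (y/2) ∂/∂z`, in the coordinates `(x, y, z)`. -/
def X₁ (g : Heis) : ℝ × ℝ × ℝ := (1, 0, -(g.b / 2))

/-- The left-invariant field `X₂ = ∂/∂y + (x/2) ∂/∂z`, in the coordinates `(x, y, z)`. -/
def X₂ (g : Heis) : ℝ × ℝ × ℝ := (0, 1, g.a / 2)

/-- On the interval `I` the curve `g` in `G` is Lipschitz and horizontal, and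
`g' = u₁ X₁(g) + u₂ X₂(g)` almost everywhere; `(u₁, u₂)` are thus the components of its velocity in
the orthonormal frame `(X₁, X₂)`. -/
structure IsHorizontalOn (g : ℝ → Heis) (u₁ u₂ : ℝ → ℝ) (I : Set ℝ) : Prop where
  lipschitz : ∃ K, LipschitzOnWith K (fun t => (g t).xyz) I
  velocity : ∀ᵐ t ∂(MeasureTheory.volume.restrict I),
    HasDerivWithinAt (fun t => (g t).xyz) (u₁ t • X₁ (g t) + u₂ t • X₂ (g t)) I t

/-- Left translations preserve the horizontal curves and their velocity components (so the fields
`X₁`, `X₂` descend to the quotients of `G` by left multiplications). -/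
theorem IsHorizontalOn.mul_left {g : ℝ → Heis} {u₁ u₂ : ℝ → ℝ} {I : Set ℝ}
    (hg : IsHorizontalOn g u₁ u₂ I) (k : Heis) :
    IsHorizontalOn (fun t => k * g t) u₁ u₂ I := by
  let A : ℝ × ℝ × ℝ →L[ℝ] ℝ × ℝ × ℝ :=
    (ContinuousLinearMap.fst ℝ ℝ (ℝ × ℝ)).prod
      (((ContinuousLinearMap.fst ℝ ℝ ℝ).comp (ContinuousLinearMap.snd ℝ ℝ (ℝ × ℝ))).prod
        ((ContinuousLinearMap.snd ℝ ℝ ℝ).comp (ContinuousLinearMap.snd ℝ ℝ (ℝ × ℝ))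
          + (k.a / 2) • (ContinuousLinearMap.fst ℝ ℝ ℝ).comp (ContinuousLinearMap.snd ℝ ℝ (ℝ × ℝ))
          - (k.b / 2) • (ContinuousLinearMap.fst ℝ ℝ (ℝ × ℝ))))
  have key : (fun t => (k * g t).xyz) = fun t => A ((g t).xyz) + k.xyz := by
    funext t
    simp only [A, xyz, mul_a, mul_b, mul_c]
    ext <;> simp <;> ring
  obtain ⟨K, hK⟩ := hg.lipschitz
  refine ⟨⟨‖A‖₊ * K, ?_⟩, ?_⟩
  · rw [key]
    have h1 := A.lipschitz.comp_lipschitzOnWith hK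
    intro s hs t ht
    have h2 := h1 hs ht
    simp only [Function.comp_apply] at h2
    rwa [edist_add_right]
  · filter_upwards [hg.velocity] with t ht
    rw [key]
    have h1 : u₁ t • X₁ (k * g t) + u₂ t • X₂ (k * g t)
        = A (u₁ t • X₁ (g t) + u₂ t • X₂ (g t)) := by
      simp only [A, X₁, X₂, mul_a, mul_b]
      ext <;> simp <;> ring
    rw [h1]
    exact (A.hasFDerivAt.comp_hasDerivWithinAt t ht).add_const k.xyz

/-- The sub-Riemannian length of a curve on `[0, T]` with velocity components `(u₁, u₂)` in the
orthonormal frame. -/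
def srLength (u₁ u₂ : ℝ → ℝ) (T : ℝ) : ℝ≥0∞ :=
  ∫⁻ t in Set.Icc 0 T, ENNReal.ofReal (Real.sqrt (u₁ t ^ 2 + u₂ t ^ 2))

/-- The sub-Riemannian distance on `G`: the infimum of the lengths of the horizontal curves that
connect `g₀` with `g₁` (it would be `∞` if there were no such curves). -/
def srDist (g₀ g₁ : Heis) : ℝ≥0∞ :=
  sInf {l | ∃ (T : ℝ) (g : ℝ → Heis) (u₁ u₂ : ℝ → ℝ), 0 < T ∧
    IsHorizontalOn g u₁ u₂ (Set.Icc 0 T) ∧ g 0 = g₀ ∧ g T = g₁ ∧ l = srLength u₁ u₂ T}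

/-- The closed sub-Riemannian ball of radius `R` in `G` centered at the identity. -/
def srBall (R : ℝ) : Set Heis := {g | srDist 1 g ≤ ENNReal.ofReal R}

/-- The discrete Heisenberg group `H`: the matrices with integer entries. -/
def lattice : Subgroup Heis where
  carrier := {g | ∃ m n k : ℤ, g = ⟨m, n, k⟩}
  one_mem' := ⟨0, 0, 0, by ext <;> simp⟩
  mul_mem' := by
    rintro _ _ ⟨m, n, k, rfl⟩ ⟨m', n', k', rfl⟩
    exact ⟨m + m', n + n', k + k' + m * n', by ext <;> simp⟩
  inv_mem' := by
    rintro _ ⟨m, n, k, rfl⟩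
    exact ⟨-m, -n, -k + m * n, by ext <;> simp⟩

end Heis

/-- The Heisenberg nil-manifold `M`: the space of the right cosets `H g`, `g ∈ G`. -/
def Nilmanifold : Type := Quotient (QuotientGroup.rightRel Heis.lattice)

namespace Nilmanifold

/-- The projection `g ↦ H g`. -/
def proj (g : Heis) : Nilmanifold := Quotient.mk (QuotientGroup.rightRel Heis.lattice) g

theorem proj_eq_iff (g g' : Heis) : proj g = proj g' ↔ ∃ h ∈ Heis.lattice, g' = h * g := by
  have h1 : proj g = proj g' ↔ g' * g⁻¹ ∈ Heis.lattice :=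
    (Quotient.eq (r := QuotientGroup.rightRel Heis.lattice)).trans QuotientGroup.rightRel_apply
  rw [h1]
  exact ⟨fun h => ⟨_, h, by simp⟩, by rintro ⟨h, hh, rfl⟩; simpa using hh⟩

/-- The curve `q : [0, T] → M` is Lipschitz and horizontal for the projected sub-Riemannian
structure, with velocity components `(u₁, u₂)` in the orthonormal frame `X₁' = π_* X₁`,
`X₂' = π_* X₂`. The charts of `M` are the local inverses of the covering `π : G → M`, so this means
that near every time the curve is, in such a chart, a horizontal curve of `G` with these velocity
components. -/
def IsHorizontal (q : ℝ → Nilmanifold) (u₁ u₂ : ℝ → ℝ) (T : ℝ) : Prop :=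
  ∀ t₀ ∈ Set.Icc 0 T, ∃ ε > 0, ∃ g : ℝ → Heis,
    Heis.IsHorizontalOn g u₁ u₂ (Set.Icc 0 T ∩ Set.Icc (t₀ - ε) (t₀ + ε)) ∧
    ∀ t ∈ Set.Icc 0 T ∩ Set.Icc (t₀ - ε) (t₀ + ε), proj (g t) = q t

/-- The sub-Riemannian distance on `M`: the infimum of the lengths of the horizontal curves in `M`
that connect `q₀` with `q₁`. -/
def srDist (q₀ q₁ : Nilmanifold) : ℝ≥0∞ :=
  sInf {l | ∃ (T : ℝ) (q : ℝ → Nilmanifold) (u₁ u₂ : ℝ → ℝ), 0 < T ∧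
    IsHorizontal q u₁ u₂ T ∧ q 0 = q₀ ∧ q T = q₁ ∧ l = Heis.srLength u₁ u₂ T}

/-- The closed sub-Riemannian ball of radius `t` in `M` centered at `q₀ = π(Id)`. -/
def srBall (t : ℝ) : Set Nilmanifold := {q | srDist (proj 1) q ≤ ENNReal.ofReal t}

/-- The covering radius of `M` from the base point `π(Id)`. -/
def coveringRadius : ℝ := sInf {t : ℝ | 0 < t ∧ srBall t = Set.univ}

end Nilmanifold

end

/-! A horizontal curve from the identity is determined by its plane projection $(x,y)$: the lengths
agree, and $z$ is the signed area swept. The distance is thus a Dido problem. A curve in $M$ lifts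
with the same controls (`IsHorizontal.exists_lift`), so reaching $\pi(\bar g)$ from
$\pi(\mathrm{Id})$ means reaching some point of $H\bar g$ from the identity. By `far_of_mem_lattice`
such a point has a planar coordinate of size at least $1$, or lies over $(\pm\frac12,\pm\frac12)$
with $|z|\ge\frac18$.

The first kind is too far because `arcLength` is below $0.92$. For the second, a curve with chord
$1/\sqrt2$ and area at least $\frac18$ is no shorter than the circular arc with exactly these data.
This is `isoperimetric`, proved by calibration: an explicit function of position, area and elapsed
length cannot increase along any competitor, so no existence or regularity theory of minimizers is
needed. Since $\tilde g^{-1}\bar g\in H\bar g$ is the endpoint of such an arc, `srDist_eq_arcLength`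
follows, and no point of $H\bar g$ is closer to the identity.

If the arc has half-angle $\varphi$, its area condition reads
$\varphi=\sin^2\varphi+\sin\varphi\cos\varphi$ and its length is $\varphi/(\sqrt2\sin\varphi)$; the
numerical bounds come from locating $\varphi$ in $(1.205,1.21)$. -/

noncomputable section

open MeasureTheory

/-! ### Absolutely continuous functions -/

namespace AbsolutelyContinuousOnInterval

/-- An absolutely continuous function with nonpositive derivative almost everywhere does not
increase. -/
theorem le_of_ae_hasDerivAt_nonpos {f : ℝ → ℝ} {a b : ℝ} (hab : a ≤ b)
    (hf : AbsolutelyContinuousOnInterval f a b)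
    (h : ∀ᵐ t, t ∈ Set.Ioo a b → ∃ f', HasDerivAt f f' t ∧ f' ≤ 0) : f b ≤ f a := by
  have h1 := hf.integral_deriv_eq_sub
  have h2 : ∫ t in a..b, deriv f t ≤ 0 := by
    rw [intervalIntegral.integral_of_le hab, integral_Ioc_eq_integral_Ioo]
    refine integral_nonpos_of_ae ?_
    filter_upwards [(ae_restrict_iff' measurableSet_Ioo).2 h] with t ht
    obtain ⟨f', h', hle⟩ := ht
    simpa [h'.deriv] using hle
  linarith

/-- The composition of a Lipschitz function with an absolutely continuous one is absolutely
continuous. -/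
theorem lipschitz_comp {f g : ℝ → ℝ} {a b : ℝ} {K : NNReal} {s : Set ℝ}
    (hf : LipschitzOnWith K f s) (hg : AbsolutelyContinuousOnInterval g a b)
    (hgs : Set.MapsTo g (Set.uIcc a b) s) :
    AbsolutelyContinuousOnInterval (fun t => f (g t)) a b := by
  unfold AbsolutelyContinuousOnInterval at hg ⊢
  refine squeeze_zero' ?_ ?_ (by simpa using hg.const_mul (K : ℝ))
  · exact Filter.Eventually.of_forall fun _ => Finset.sum_nonneg fun i hi => dist_nonneg
  rw [Filter.eventually_inf_principal]
  filter_upwards with E hE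
  rw [Finset.mul_sum]
  refine Finset.sum_le_sum fun i hi => ?_
  have hm := hE.1 i hi
  exact hf.dist_le_mul _ (hgs hm.1) _ (hgs hm.2)

/-- The composition of a `C¹` function with an absolutely continuous one is absolutely
continuous. -/
theorem contDiffOn_comp {f g : ℝ → ℝ} {a b c d : ℝ}
    (hf : ContDiffOn ℝ 1 f (Set.Icc c d)) (hg : AbsolutelyContinuousOnInterval g a b)
    (hgs : Set.MapsTo g (Set.uIcc a b) (Set.Icc c d)) :
    AbsolutelyContinuousOnInterval (fun t => f (g t)) a b := by
  obtain ⟨K, hK⟩ := hf.exists_lipschitzOnWith (by decide) (convex_Icc _ _) isCompact_Icc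
  exact lipschitz_comp hK hg hgs

theorem const (k a b : ℝ) : AbsolutelyContinuousOnInterval (fun _ => k) a b :=
  (LipschitzWith.const k).lipschitzOnWith.absolutelyContinuousOnInterval

end AbsolutelyContinuousOnInterval

/-! ### The isoperimetric inequality by calibration -/

/-- On `[0, T]` the plane curve `(x, y)` starts at the origin, sweeps the signed area `z`, and has
speed at most `σ'`, where `σ` increases from `0` to `ℓ`. -/
structure SweepsArea (x y z σ : ℝ → ℝ) (T ℓ : ℝ) : Prop where
  T_pos : 0 < T
  ac_x : AbsolutelyContinuousOnInterval x 0 T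
  ac_y : AbsolutelyContinuousOnInterval y 0 T
  ac_z : AbsolutelyContinuousOnInterval z 0 T
  ac_σ : AbsolutelyContinuousOnInterval σ 0 T
  x_zero : x 0 = 0
  y_zero : y 0 = 0
  z_zero : z 0 = 0
  σ_zero : σ 0 = 0
  σ_end : σ T = ℓ
  mapsTo : Set.MapsTo σ (Set.uIcc 0 T) (Set.Icc 0 ℓ)
  deriv : ∀ᵐ t, t ∈ Set.Ioo 0 T → ∃ x' y' σ', HasDerivAt x x' t ∧ HasDerivAt y y' t ∧
    HasDerivAt z ((x t * y' - y t * x') / 2) t ∧ HasDerivAt σ σ' t ∧ 0 ≤ σ' ∧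
    x' ^ 2 + y' ^ 2 ≤ σ' ^ 2

/-- Completing the square in $|(a,b)-S(m,n)|^2\ge0$ gives this. It is the pointwise inequality
behind every calibration below, with $(m,n)$ the gradient of the calibrating function. -/
theorem two_mul_inner_le {a b m n S : ℝ} (hS : 0 ≤ S) (h : a ^ 2 + b ^ 2 ≤ S ^ 2) :
    2 * (m * a + n * b) ≤ S * (1 + m ^ 2 + n ^ 2) := by
  rcases hS.eq_or_lt with rfl | hS
  · have ha : a = 0 := by nlinarith
    have hb : b = 0 := by nlinarith
    simp [ha, hb]
  · refine le_of_mul_le_mul_left ?_ hS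
    nlinarith [sq_nonneg (a - S * m), sq_nonneg (b - S * n)]

namespace SweepsArea

variable {x y z σ : ℝ → ℝ} {T ℓ : ℝ}

/-- The length of a curve is at least the displacement in any direction. -/
theorem displacement_le (h : SweepsArea x y z σ T ℓ) {p q : ℝ} (hpq : p ^ 2 + q ^ 2 = 1) :
    p * x T + q * y T ≤ ℓ := by
  have key := AbsolutelyContinuousOnInterval.le_of_ae_hasDerivAt_nonpos h.T_pos.le
    (((h.ac_x.const_mul p).fun_add (h.ac_y.const_mul q)).fun_sub h.ac_σ) (by
      filter_upwards [h.deriv] with t ht hT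
      obtain ⟨x', y', σ', hx, hy, -, hσ, hσ0, hle⟩ := ht hT
      refine ⟨_, ((hx.const_mul p).add (hy.const_mul q)).sub hσ, ?_⟩
      nlinarith [two_mul_inner_le (m := p) (n := q) hσ0 hle])
  simp only [h.x_zero, h.y_zero, h.σ_zero, h.σ_end] at key
  linarith

/-- The isoperimetric inequality for a curve that sweeps the area `z` and whose chord has
length `c`, in Legendre-dual form: equality holds for the circular arc with curvature `κ`. -/
theorem isoperimetric (h : SweepsArea x y z σ T ℓ) (hℓ : 0 < ℓ) {κ c p q : ℝ} (hκ : κ ≠ 0)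
    (hκℓ : |κ * ℓ| < Real.pi) (hpq : p ^ 2 + q ^ 2 = 1) (hx : x T = c * p) (hy : y T = c * q) :
    2 * κ * z T + κ * c ^ 2 / 2 * (Real.cos (κ * ℓ / 2) / Real.sin (κ * ℓ / 2)) ≤ ℓ := by
  set A := κ * ℓ / 2 with hA
  have hApi : |A| < Real.pi / 2 := by
    rw [hA, abs_div, abs_two]; linarith
  have hA0 : A ≠ 0 := by positivity
  -- The angle $\kappa u-A$ stays in $[-|A|,|A|]$, inside $(-\pi/2,\pi/2)$, so its secant and
  -- tangent are smooth on the range of $\sigma$.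
  have hcos : ∀ u ∈ Set.Icc 0 ℓ, 0 < Real.cos (κ * u - A) := by
    intro u hu
    have h1 : |κ * u - A| ≤ |A| := by
      have : κ * u - A = κ * (u - ℓ / 2) := by rw [hA]; ring
      rw [this, hA, mul_div_assoc, abs_mul, abs_mul]
      gcongr 1
      rw [abs_of_pos (half_pos hℓ), abs_le]
      constructor <;> linarith [hu.1, hu.2]
    have h2 := abs_lt.1 (h1.trans_lt hApi)
    exact Real.cos_pos_of_mem_Ioo ⟨h2.1, h2.2⟩
  have hcA : 0 < Real.cos A := by
    have := abs_lt.1 hApi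
    exact Real.cos_pos_of_mem_Ioo ⟨this.1, this.2⟩
  have hsA : Real.sin A ≠ 0 := by
    have := abs_lt.1 hApi
    rw [Ne, Real.sin_eq_zero_iff_of_lt_of_lt (by linarith [Real.pi_pos])
      (by linarith [Real.pi_pos])]
    exact hA0
  -- For $\kappa>0$ this value of the free parameter $r$ gives the best bound: it maximizes the
  -- endpoint contribution $2rc/\cos A-(2r^2/\kappa)\tan A$. It equals $1$ when $c$ is the chord of
  -- the arc of curvature $\kappa$ and length $\ell$.
  set r := κ * c / (2 * Real.sin A) with hr
  have hlin : ContDiff ℝ 1 fun u : ℝ => κ * u - A := by fun_prop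
  have hC : ContDiffOn ℝ 1 (fun u => (Real.cos (κ * u - A))⁻¹) (Set.Icc 0 ℓ) :=
    (Real.contDiff_cos.comp hlin).contDiffOn.inv fun u hu => (hcos u hu).ne'
  have hTn : ContDiffOn ℝ 1 (fun u => Real.sin (κ * u - A) * (Real.cos (κ * u - A))⁻¹)
      (Set.Icc 0 ℓ) := (Real.contDiff_sin.comp hlin).contDiffOn.mul hC
  have acC := AbsolutelyContinuousOnInterval.contDiffOn_comp hC h.ac_σ h.mapsTo
  have acT := AbsolutelyContinuousOnInterval.contDiffOn_comp hTn h.ac_σ h.mapsTo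
  have acs : AbsolutelyContinuousOnInterval (fun t => p * x t + q * y t - c / 2) 0 T :=
    ((h.ac_x.const_mul p).fun_add (h.ac_y.const_mul q)).fun_sub (.const _ _ _)
  have acw : AbsolutelyContinuousOnInterval (fun t => p * y t - q * x t) 0 T :=
    (h.ac_y.const_mul p).fun_sub (h.ac_x.const_mul q)
  -- Let $s$ be the coordinate along the chord from its midpoint, $w$ the transverse one, and
  -- $\tau=\kappa\sigma-A$. The calibrating function is $\kappa(2z-\frac c2w+sw)-\kappa
  -- s^2\tan\tau+2rs\sec\tau-\frac{r^2}\kappa\tan\tau-\sigma$. The first bracket has derivative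
  -- $2sw'$.
  have key := AbsolutelyContinuousOnInterval.le_of_ae_hasDerivAt_nonpos h.T_pos.le
    ((((((h.ac_z.const_mul 2).fun_sub (acw.const_mul (c / 2))).fun_add
      (acs.fun_mul acw)).const_mul κ).fun_add
      ((((acT.fun_mul (acs.fun_mul acs)).const_mul (-κ)).fun_add
      ((acC.fun_mul acs).const_mul (2 * r))).fun_add
      (acT.const_mul (-(r ^ 2 / κ))))).fun_sub h.ac_σ) (by
      filter_upwards [h.deriv] with t ht hT
      obtain ⟨x', y', σ', hx, hy, hz, hσ, hσ0, hle⟩ := ht hT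
      have hc := hcos _ (h.mapsTo (Set.Ioo_subset_Icc_self.trans Set.Icc_subset_uIcc hT))
      have hs := ((hx.const_mul p).add (hy.const_mul q)).sub_const (c / 2)
      have hw := (hy.const_mul p).sub (hx.const_mul q)
      have hτ := (hσ.const_mul κ).sub_const A
      have hCd := (hτ.cos).inv hc.ne'
      have hTd := hτ.sin.mul hCd
      refine ⟨_, (((((hz.const_mul 2).sub (hw.const_mul (c / 2))).add
        (hs.mul hw)).const_mul κ).add
        ((((hTd.mul (hs.mul hs)).const_mul (-κ)).add
        ((hCd.mul hs).const_mul (2 * r))).add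
        (hTd.const_mul (-(r ^ 2 / κ))))).sub hσ, ?_⟩
      -- With this $(m,n)$ the derivative is exactly $2(ms'+nw')-\sigma'(1+m^2+n^2)$; the terms in
      -- $\sigma'$ match by $\tan^2=\sec^2-1$.
      have hin := two_mul_inner_le (a := p * x' + q * y') (b := p * y' - q * x')
        (m := (r - κ * Real.sin (κ * σ t - A) * (p * x t + q * y t - c / 2))
          * (Real.cos (κ * σ t - A))⁻¹)
        (n := κ * (p * x t + q * y t - c / 2)) hσ0 (by
          have : (p * x' + q * y') ^ 2 + (p * y' - q * x') ^ 2
              = (p ^ 2 + q ^ 2) * (x' ^ 2 + y' ^ 2) := by ring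
          rw [this, hpq, one_mul]
          exact hle)
      have hsc := Real.sin_sq_add_cos_sq (κ * σ t - A)
      simp only [Pi.mul_apply, Pi.add_apply, Pi.sub_apply, Pi.inv_apply]
      generalize Real.sin (κ * σ t - A) = S at *
      generalize Real.cos (κ * σ t - A) = C at *
      have hxy : x t * y' - y t * x' = (p ^ 2 + q ^ 2) * (x t * y' - y t * x') := by
        rw [hpq, one_mul]
      rw [hxy]
      refine le_of_eq_of_le ?_ (sub_nonpos.2 hin)
      have hS : S ^ 2 = 1 - C ^ 2 := by linarith
      have e1 : C * (κ * σ') * C⁻¹ + S * (-(-S * (κ * σ')) / C ^ 2) = κ * σ' * C⁻¹ ^ 2 := by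
        field_simp
        rw [hS]
        ring
      have e2 : -(-S * (κ * σ')) / C ^ 2 = S * (κ * σ') * C⁻¹ ^ 2 := by field_simp
      have e3 : -(r ^ 2 / κ) * (κ * σ' * C⁻¹ ^ 2) = -r ^ 2 * σ' * C⁻¹ ^ 2 := by field_simp
      have e4 : (S * C⁻¹) ^ 2 = C⁻¹ ^ 2 - 1 := by
        field_simp
        exact hS
      rw [e1, e2, e3]
      linear_combination κ ^ 2 * σ' * (p * x t + q * y t - c / 2) ^ 2 * e4)
  have e1 : p * x T + q * y T - c / 2 = c / 2 := by
    rw [hx, hy]; linear_combination c * hpq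
  have e2 : p * y T - q * x T = 0 := by rw [hx, hy]; ring
  have e3 : κ * ℓ - A = A := by rw [hA]; ring
  simp only [e1, e2, e3, h.x_zero, h.y_zero, h.z_zero, h.σ_zero, h.σ_end, mul_zero, zero_sub,
    Real.sin_neg, Real.cos_neg, add_zero, sub_zero, zero_add] at key
  have hS : Real.sin A ^ 2 = 1 - Real.cos A ^ 2 := by linarith [Real.sin_sq_add_cos_sq A]
  have e4 : κ * c ^ 2 / 2 * (Real.cos A / Real.sin A)
      = -κ * (Real.sin A * (Real.cos A)⁻¹ * c ^ 2 / 2) + 2 * r * ((Real.cos A)⁻¹ * c)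
        - r ^ 2 / κ * (Real.sin A * (Real.cos A)⁻¹) * 2 := by
    rw [hr]
    field_simp
    rw [hS]
    ring
  rw [e4]
  linarith

end SweepsArea

/-! ### Horizontal curves as plane curves sweeping area -/

namespace Heis

/-- A horizontal curve shorter than `ℓ` that starts at the identity sweeps the area given by its
third exponential coordinate. -/
theorem IsHorizontalOn.sweepsArea {g : ℝ → Heis} {u₁ u₂ : ℝ → ℝ} {T ℓ : ℝ} (hT : 0 < T)
    (hg : IsHorizontalOn g u₁ u₂ (Set.Icc 0 T)) (h0 : g 0 = 1)
    (hℓ : srLength u₁ u₂ T < ENNReal.ofReal ℓ) :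
    ∃ σ, SweepsArea (fun t => (g t).a) (fun t => (g t).b)
      (fun t => (g t).c - (g t).a * (g t).b / 2) σ T ℓ := by
  obtain ⟨K, hK⟩ := hg.lipschitz
  set x : ℝ → ℝ := fun t => (g t).a with hx
  set y : ℝ → ℝ := fun t => (g t).b with hy
  set z : ℝ → ℝ := fun t => (g t).c - (g t).a * (g t).b / 2 with hz
  rw [← Set.uIcc_of_le hT.le] at hK
  have hd : ∀ᵐ t, t ∈ Set.Ioo 0 T → HasDerivAt x (u₁ t) t ∧ HasDerivAt y (u₂ t) t ∧
      HasDerivAt z ((x t * u₂ t - y t * u₁ t) / 2) t := by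
    filter_upwards [(ae_restrict_iff' measurableSet_Icc).1 hg.velocity] with t ht htT
    have h1 := (ht (Set.Ioo_subset_Icc_self htT)).hasDerivAt (Icc_mem_nhds htT.1 htT.2)
    have h2 := h1.hasFDerivAt
    refine ⟨?_, ?_, ?_⟩
    · have := (hasFDerivAt_fst.comp t h2).hasDerivAt
      simpa [Function.comp_def, xyz, X₁, X₂] using this
    · have := (hasFDerivAt_fst.comp t (hasFDerivAt_snd.comp t h2)).hasDerivAt
      simpa [Function.comp_def, xyz, X₁, X₂] using this
    · have := (hasFDerivAt_snd.comp t (hasFDerivAt_snd.comp t h2)).hasDerivAt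
      refine (this.congr_deriv ?_)
      simp [X₁, X₂, hx, hy]
      ring
  -- The controls are not assumed measurable, so the speed is built from `deriv`, which is
  -- measurable and agrees with them almost everywhere.
  set v : ℝ → ℝ := fun t => Real.sqrt (deriv x t ^ 2 + deriv y t ^ 2) with hv
  have hvm : Measurable v := by
    have := measurable_deriv x
    have := measurable_deriv y
    fun_prop
  have hlen : ∫⁻ t in Set.Icc 0 T, ENNReal.ofReal (v t) = srLength u₁ u₂ T := by
    rw [srLength, setLIntegral_congr Ioo_ae_eq_Icc.symm, setLIntegral_congr Ioo_ae_eq_Icc.symm]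
    refine lintegral_congr_ae ?_
    filter_upwards [(ae_restrict_iff' measurableSet_Ioo).2 hd] with t ht
    rw [hv]
    simp only [ht.1.deriv, ht.2.1.deriv]
  have hint : Integrable v (volume.restrict (Set.Icc 0 T)) := by
    refine (lintegral_ofReal_ne_top_iff_integrable hvm.aestronglyMeasurable
      (Filter.Eventually.of_forall fun t => Real.sqrt_nonneg _)).1 ?_
    rw [hlen]
    exact hℓ.ne_top
  have hii : IntervalIntegrable v volume 0 T :=
    (intervalIntegrable_iff_integrableOn_Icc_of_le hT.le).2 hint
  have hlt : ∫ t in (0 : ℝ)..T, v t < ℓ := by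
    rw [intervalIntegral.integral_of_le hT.le, ← integral_Icc_eq_integral_Ioc]
    rw [← hlen, ← ofReal_integral_eq_lintegral_ofReal hint
      (Filter.Eventually.of_forall fun t => Real.sqrt_nonneg _)] at hℓ
    exact (ENNReal.ofReal_lt_ofReal_iff_of_nonneg
      (integral_nonneg fun t => Real.sqrt_nonneg _)).1 hℓ
  -- The unused length is spread uniformly over $[0,T]$, so that $\sigma$ ends exactly at $\ell$.
  set δ := (ℓ - ∫ t in (0 : ℝ)..T, v t) / T with hδ
  have hδ0 : 0 < δ := div_pos (sub_pos.2 hlt) hT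
  have hend : (∫ t in (0 : ℝ)..T, v t) + δ * T = ℓ := by
    rw [hδ]; field_simp; ring
  refine ⟨fun t => (∫ s in (0 : ℝ)..t, v s) + δ * t, hT, ?_, ?_, ?_, ?_, ?_, ?_, ?_, ?_, hend,
    ?_, ?_⟩
  · exact (LipschitzWith.prod_fst.comp_lipschitzOnWith hK).absolutelyContinuousOnInterval
  · exact (LipschitzWith.prod_fst.comp_lipschitzOnWith
      (LipschitzWith.prod_snd.comp_lipschitzOnWith hK)).absolutelyContinuousOnInterval
  · exact (LipschitzWith.prod_snd.comp_lipschitzOnWith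
      (LipschitzWith.prod_snd.comp_lipschitzOnWith hK)).absolutelyContinuousOnInterval
  · refine (hii.absolutelyContinuousOnInterval_intervalIntegral (by simp)).fun_add ?_
    exact ContDiffOn.absolutelyContinuousOnInterval (by fun_prop)
  · simp [hx, h0]
  · simp [hy, h0]
  · simp [hz, h0]
  · simp
  · intro t ht
    rw [Set.uIcc_of_le hT.le] at ht
    have h1 : ∫ s in (0 : ℝ)..t, v s ≤ ∫ s in (0 : ℝ)..T, v s :=
      intervalIntegral.integral_mono_interval le_rfl ht.1 ht.2
        (Filter.Eventually.of_forall fun t => Real.sqrt_nonneg _) hii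
    have h2 : 0 ≤ ∫ s in (0 : ℝ)..t, v s :=
      intervalIntegral.integral_nonneg ht.1 fun t _ => Real.sqrt_nonneg _
    have h3 : δ * t ≤ δ * T := by gcongr; exact ht.2
    exact ⟨add_nonneg h2 (mul_nonneg hδ0.le ht.1), by linarith⟩
  · filter_upwards [hd, hii.ae_hasDerivAt_integral] with t h1 h2 ht
    obtain ⟨hx', hy', hz'⟩ := h1 ht
    have h3 := h2 (Set.Icc_subset_uIcc (Set.Ioo_subset_Icc_self ht)) 0 (by simp)
    refine ⟨_, _, v t + δ, hx', hy', hz', ?_, ?_, ?_⟩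
    · exact (h3.add ((hasDerivAt_id t).const_mul δ)).congr_deriv (by simp)
    · exact add_nonneg (Real.sqrt_nonneg _) hδ0.le
    · have hvt : v t = Real.sqrt (u₁ t ^ 2 + u₂ t ^ 2) := by
        rw [hv]
        simp only [hx'.deriv, hy'.deriv]
      have h4 : v t ^ 2 = u₁ t ^ 2 + u₂ t ^ 2 := by
        rw [hvt, Real.sq_sqrt (by positivity)]
      have h5 : 0 ≤ v t := Real.sqrt_nonneg _
      nlinarith

end Heis

/-! ### Numerical bounds and the minimizing arc -/

theorem sin_bounds_cubic {y : ℝ} (h0 : 0 ≤ y) (h1 : y ≤ 1) :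
    y - y ^ 3 / 6 - y ^ 5 / 100 ≤ Real.sin y ∧ Real.sin y ≤ y - y ^ 3 / 6 + y ^ 5 / 100 := by
  have := abs_le.1 (Real.sin_bound (x := y) (by rwa [abs_of_nonneg h0]))
  rw [abs_of_nonneg h0] at this
  constructor <;> linarith [this.1, this.2]

/-- Three applications of the double-angle formula; at $x/8$ the cubic Taylor bounds are already
sharp enough. -/
theorem cos_eq_sin_eighth (x : ℝ) :
    Real.cos x = 2 * (2 * (1 - 2 * Real.sin (x / 8) ^ 2) ^ 2 - 1) ^ 2 - 1 := by
  have h1 : x = 2 * (2 * (2 * (x / 8))) := by ring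
  conv_lhs => rw [h1]
  rw [Real.cos_two_mul, Real.cos_two_mul, Real.cos_two_mul]
  have := Real.sin_sq_add_cos_sq (x / 8)
  have h2 : 2 * Real.cos (x / 8) ^ 2 - 1 = 1 - 2 * Real.sin (x / 8) ^ 2 := by linarith
  rw [h2]

/-- Two-sided bounds for the cosine by three duplications from the cubic bounds for the sine. -/
theorem cos_bounds {x l u : ℝ} (hx0 : 0 ≤ x) (hx : x ≤ 8)
    (hl : 0 ≤ x / 8 - (x / 8) ^ 3 / 6 - (x / 8) ^ 5 / 100)
    (hs : x / 8 - (x / 8) ^ 3 / 6 + (x / 8) ^ 5 / 100 ≤ 3 / 10)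
    (hl' : l ≤ 2 * (2 * (1 - 2 * (x / 8 - (x / 8) ^ 3 / 6 + (x / 8) ^ 5 / 100) ^ 2) ^ 2 - 1) ^ 2 - 1)
    (hu' : 2 * (2 * (1 - 2 * (x / 8 - (x / 8) ^ 3 / 6 - (x / 8) ^ 5 / 100) ^ 2) ^ 2 - 1) ^ 2 - 1 ≤ u) :
    l ≤ Real.cos x ∧ Real.cos x ≤ u := by
  obtain ⟨h1, h2⟩ := sin_bounds_cubic (y := x / 8) (by positivity) (by linarith)
  rw [cos_eq_sin_eighth]
  generalize Real.sin (x / 8) = s at *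
  generalize x / 8 - (x / 8) ^ 3 / 6 - (x / 8) ^ 5 / 100 = a at *
  generalize x / 8 - (x / 8) ^ 3 / 6 + (x / 8) ^ 5 / 100 = b at *
  -- The cutoff $3/10$ keeps $1-2q^2$ and $2(1-2q^2)^2-1$ nonnegative, so each squaring preserves
  -- order.
  have mono : ∀ {p q : ℝ}, 0 ≤ p → p ≤ q → q ≤ 3 / 10 →
      2 * (2 * (1 - 2 * q ^ 2) ^ 2 - 1) ^ 2 - 1 ≤ 2 * (2 * (1 - 2 * p ^ 2) ^ 2 - 1) ^ 2 - 1 := by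
    intro p q hp hpq hq
    have e1 : p ^ 2 ≤ q ^ 2 := by gcongr
    have e2 : q ^ 2 ≤ 9 / 100 := by nlinarith
    have e3 : (1 - 2 * q ^ 2) ^ 2 ≤ (1 - 2 * p ^ 2) ^ 2 := by
      apply pow_le_pow_left₀ <;> linarith
    have e4 : 1 / 2 ≤ (1 - 2 * q ^ 2) ^ 2 := by nlinarith
    have e5 : (2 * (1 - 2 * q ^ 2) ^ 2 - 1) ^ 2 ≤ (2 * (1 - 2 * p ^ 2) ^ 2 - 1) ^ 2 := by
      apply pow_le_pow_left₀ <;> linarith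
    linarith
  exact ⟨hl'.trans (mono (hl.trans h1) h2 hs), (mono hl h1 (h2.trans hs)).trans hu'⟩

theorem cos_one_point_two_zero_five : 0.35765 ≤ Real.cos 1.205 ∧ Real.cos 1.205 ≤ 0.35775 := by
  apply cos_bounds <;> norm_num

theorem cos_one_point_two_one : 0.35297 ≤ Real.cos 1.21 ∧ Real.cos 1.21 ≤ 0.35307 := by
  apply cos_bounds <;> norm_num

theorem sin_one_point_two_zero_five : 0.9338 ≤ Real.sin 1.205 ∧ Real.sin 1.205 ≤ 0.9339 := by
  obtain ⟨h1, h2⟩ := cos_one_point_two_zero_five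
  have h3 := Real.sin_sq_add_cos_sq 1.205
  have h4 : 0 ≤ Real.sin 1.205 :=
    Real.sin_nonneg_of_nonneg_of_le_pi (by norm_num) (by linarith [Real.pi_gt_three])
  constructor <;> nlinarith

theorem sin_one_point_two_one : 0.9355 ≤ Real.sin 1.21 ∧ Real.sin 1.21 ≤ 0.9357 := by
  obtain ⟨h1, h2⟩ := cos_one_point_two_one
  have h3 := Real.sin_sq_add_cos_sq 1.21
  have h4 : 0 ≤ Real.sin 1.21 :=
    Real.sin_nonneg_of_nonneg_of_le_pi (by norm_num) (by linarith [Real.pi_gt_three])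
  constructor <;> nlinarith

/-- The half-angle of the circular arc whose segment has the area of the square built on half of
its chord. -/
theorem exists_arcAngle : ∃ φ : ℝ, 1.205 < φ ∧ φ < 1.21 ∧
    φ = Real.sin φ ^ 2 + Real.sin φ * Real.cos φ := by
  have hc : ContinuousOn (fun φ : ℝ => Real.sin φ ^ 2 + Real.sin φ * Real.cos φ - φ)
      (Set.Icc 1.205 1.21) := by fun_prop
  have h := intermediate_value_Ioo' (by norm_num) hc
  obtain ⟨a1, a2⟩ := cos_one_point_two_zero_five
  obtain ⟨b1, b2⟩ := sin_one_point_two_zero_five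
  obtain ⟨c1, c2⟩ := cos_one_point_two_one
  obtain ⟨d1, d2⟩ := sin_one_point_two_one
  obtain ⟨φ, hφ, h0⟩ := h (show (0 : ℝ) ∈ Set.Ioo _ _ by
    constructor <;> nlinarith)
  exact ⟨φ, hφ.1, hφ.2, by simp only at h0; linarith⟩

/-- The half-angle of the minimizing arc. -/
def arcAngle : ℝ := exists_arcAngle.choose

/-- The length of the minimizing arc. -/
def arcLength : ℝ := arcAngle / (Real.sqrt 2 * Real.sin arcAngle)

theorem arcAngle_gt : 1.205 < arcAngle := exists_arcAngle.choose_spec.1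
theorem arcAngle_lt : arcAngle < 1.21 := exists_arcAngle.choose_spec.2.1
theorem arcAngle_eq : arcAngle = Real.sin arcAngle ^ 2 + Real.sin arcAngle * Real.cos arcAngle :=
  exists_arcAngle.choose_spec.2.2

theorem arcAngle_lt_pi_div_two : arcAngle < Real.pi / 2 := by
  linarith [arcAngle_lt, Real.pi_gt_three]

theorem sin_arcAngle_ge : 0.9338 ≤ Real.sin arcAngle := by
  refine sin_one_point_two_zero_five.1.trans (Real.sin_le_sin_of_le_of_le_pi_div_two ?_
    arcAngle_lt_pi_div_two.le arcAngle_gt.le)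
  linarith [Real.pi_gt_three]

theorem sin_arcAngle_le : Real.sin arcAngle ≤ 0.9357 := by
  refine (Real.sin_le_sin_of_le_of_le_pi_div_two ?_ ?_ arcAngle_lt.le).trans
    sin_one_point_two_one.2
  · linarith [Real.pi_gt_three, arcAngle_gt]
  · linarith [Real.pi_gt_three]

theorem arcLength_gt : 0.91 < arcLength := by
  have h1 : Real.sqrt 2 < 1.41422 := by
    rw [Real.sqrt_lt' (by norm_num)]; norm_num
  have h0 : 0 ≤ Real.sqrt 2 := Real.sqrt_nonneg 2
  have h2 := sin_arcAngle_ge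
  have h3 := sin_arcAngle_le
  have h4 := arcAngle_gt
  rw [arcLength, lt_div_iff₀ (by positivity)]
  nlinarith

theorem arcLength_lt : arcLength < 0.92 := by
  have h1 : 1.41421 < Real.sqrt 2 := by
    rw [Real.lt_sqrt (by norm_num)]; norm_num
  have h2 := sin_arcAngle_ge
  have h4 := arcAngle_lt
  rw [arcLength, div_lt_iff₀ (by positivity)]
  nlinarith

theorem arcLength_pos : 0 < arcLength := by linarith [arcLength_gt]

/-- The arc has curvature $2\sqrt2\sin\varphi$ and turns through $2\varphi$; this is half of
curvature times length. -/
theorem sqrt_two_mul_sin_mul_arcLength :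
    Real.sqrt 2 * Real.sin arcAngle * arcLength = arcAngle := by
  have := sin_arcAngle_ge
  rw [arcLength]
  exact mul_div_cancel₀ _ (by positivity)

/-! ### Lower bound for the distance to the lattice translates -/

namespace Heis

/-- A horizontal curve from the identity to a point at planar distance `1/√2` whose third
exponential coordinate is at least `1/8`, or to a point one of whose planar coordinates is at
least `1`, is no shorter than the minimizing arc. -/
theorem IsHorizontalOn.arcLength_le {g : ℝ → Heis} {u₁ u₂ : ℝ → ℝ} {T : ℝ} (hT : 0 < T)
    (hg : IsHorizontalOn g u₁ u₂ (Set.Icc 0 T)) (h0 : g 0 = 1)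
    (hfar : ((g T).a ^ 2 + (g T).b ^ 2 = 1 / 2 ∧ 1 / 8 ≤ |(g T).c - (g T).a * (g T).b / 2|) ∨
      1 ≤ |(g T).a| ∨ 1 ≤ |(g T).b|) :
    ENNReal.ofReal arcLength ≤ srLength u₁ u₂ T := by
  by_contra! hlt
  obtain ⟨ℓ, hℓ0, hℓ, hℓL⟩ := ENNReal.lt_iff_exists_real_btwn.1 hlt
  have hL := arcLength_lt
  replace hℓL : ℓ < arcLength := (ENNReal.ofReal_lt_ofReal_iff arcLength_pos).1 hℓL
  obtain ⟨σ, hσ⟩ := hg.sweepsArea hT h0 hℓ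
  rcases hfar with ⟨hP, hz⟩ | h | h
  · have hℓpos : 0 < ℓ := ENNReal.ofReal_pos.1 (zero_le.trans_lt hℓ)
    have hs := sin_arcAngle_ge
    have hsL := sqrt_two_mul_sin_mul_arcLength
    set z := (g T).c - (g T).a * (g T).b / 2 with hzd
    set B := Real.sqrt 2 * Real.sin arcAngle * ℓ with hB
    have h2 : Real.sqrt 2 ^ 2 = 2 := Real.sq_sqrt (by norm_num)
    have hB0 : 0 < B := by positivity
    have hBφ : B < arcAngle :=
      (mul_lt_mul_of_pos_left hℓL (by positivity)).trans_eq hsL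
    have hπ := arcAngle_lt_pi_div_two
    have hsB : 0 < Real.sin B := Real.sin_pos_of_pos_of_lt_pi hB0 (by linarith)
    -- The sign $\varepsilon$ is the orientation of the swept area; it is carried by the curvature,
    -- so both signs of $z$ are treated together.
    have main : ∀ ε : ℝ, ε ^ 2 = 1 → ε * z = |z| →
        ε * (Real.cos (ε * B) / Real.sin (ε * B)) = Real.cos B / Real.sin B → False := by
      intro ε hε hεz hcot
      have hε0 : ε ≠ 0 := by rintro rfl; norm_num at hε
      have hεa : |ε| = 1 := by
        rw [← sq_eq_sq₀ (abs_nonneg ε) zero_le_one, sq_abs, hε, one_pow]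
      have key := hσ.isoperimetric hℓpos (κ := ε * (2 * Real.sqrt 2 * Real.sin arcAngle))
        (c := Real.sqrt 2 / 2) (p := Real.sqrt 2 * (g T).a) (q := Real.sqrt 2 * (g T).b)
        (by positivity)
        (by
          rw [show ε * (2 * Real.sqrt 2 * Real.sin arcAngle) * ℓ = ε * (2 * B) by rw [hB]; ring,
            abs_mul, hεa, abs_of_pos (by positivity)]
          linarith)
        (by rw [mul_pow, mul_pow, h2]; linarith)
        (by linear_combination -(g T).a / 2 * h2) (by linear_combination -(g T).b / 2 * h2)
      have e1 : ε * (2 * Real.sqrt 2 * Real.sin arcAngle) * ℓ / 2 = ε * B := by rw [hB]; ring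
      rw [e1] at key
      have e2 : 2 * (ε * (2 * Real.sqrt 2 * Real.sin arcAngle)) * z
          = 4 * Real.sqrt 2 * Real.sin arcAngle * |z| := by rw [← hεz]; ring
      have e3 : ε * (2 * Real.sqrt 2 * Real.sin arcAngle) * (Real.sqrt 2 / 2) ^ 2 / 2 *
          (Real.cos (ε * B) / Real.sin (ε * B))
          = Real.sqrt 2 * Real.sin arcAngle / 2 * (Real.cos B / Real.sin B) := by
        rw [← hcot, div_pow, h2]; ring
      simp only [← hzd] at key
      rw [e2, e3] at key
      -- A curve that is too short has $B<\varphi$. The cotangent decreases, so the lower bound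
      -- given by `key` exceeds its value at $\varphi$, which is `arcLength`: a contradiction.
      have hcotlt : Real.cos arcAngle / Real.sin arcAngle < Real.cos B / Real.sin B := by
        rw [div_lt_div_iff₀ (by linarith) hsB]
        have : 0 < Real.sin (arcAngle - B) :=
          Real.sin_pos_of_pos_of_lt_pi (by linarith) (by linarith)
        rw [Real.sin_sub] at this
        linarith
      have hlow : arcLength ≤ 4 * Real.sqrt 2 * Real.sin arcAngle * (1 / 8) +
          Real.sqrt 2 * Real.sin arcAngle / 2 * (Real.cos arcAngle / Real.sin arcAngle) := by
        have hφ := arcAngle_eq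
        rw [arcLength, div_le_iff₀ (by positivity)]
        refine le_of_eq ?_
        field_simp
        rw [h2]
        linarith
      have h3 : 4 * Real.sqrt 2 * Real.sin arcAngle * (1 / 8)
          ≤ 4 * Real.sqrt 2 * Real.sin arcAngle * |z| := by gcongr
      have h4 : Real.sqrt 2 * Real.sin arcAngle / 2 * (Real.cos arcAngle / Real.sin arcAngle)
          ≤ Real.sqrt 2 * Real.sin arcAngle / 2 * (Real.cos B / Real.sin B) := by gcongr
      linarith
    rcases le_total 0 z with hz0 | hz0
    · exact main 1 (by norm_num) (by rw [abs_of_nonneg hz0, one_mul]) (by simp)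
    · exact main (-1) (by norm_num) (by rw [abs_of_nonpos hz0]; ring) (by simp [div_neg])
  · rcases le_abs'.1 h with h | h
    · linarith [hσ.displacement_le (p := -1) (q := 0) (by norm_num)]
    · linarith [hσ.displacement_le (p := 1) (q := 0) (by norm_num)]
  · rcases le_abs'.1 h with h | h
    · linarith [hσ.displacement_le (p := 0) (q := -1) (by norm_num)]
    · linarith [hσ.displacement_le (p := 0) (q := 1) (by norm_num)]

/-- Every lattice translate of `(1/2, 1/2, 1/2)` is at least as far from the identity as the
length of the minimizing arc. -/
theorem far_of_mem_lattice {h : Heis} (hh : h ∈ lattice) {p : Heis}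
    (hp : p = h * ⟨1 / 2, 1 / 2, 1 / 2⟩) :
    (p.a ^ 2 + p.b ^ 2 = 1 / 2 ∧ 1 / 8 ≤ |p.c - p.a * p.b / 2|) ∨ 1 ≤ |p.a| ∨ 1 ≤ |p.b| := by
  obtain ⟨m, n, k, rfl⟩ := hh
  subst hp
  have half : ∀ j : ℤ, j ≠ 0 → j ≠ -1 → 1 ≤ |(j : ℝ) + 1 / 2| := by
    intro j h0 h1
    rcases (by lia : j ≤ -2 ∨ 1 ≤ j) with h | h
    · have : (j : ℝ) ≤ -2 := by exact_mod_cast h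
      rw [le_abs']; left; linarith
    · have : (1 : ℝ) ≤ j := by exact_mod_cast h
      rw [le_abs']; right; linarith
  have eighth : ∀ j : ℤ, j % 8 ≠ 0 → ∀ r : ℝ, r = j / 8 → 1 / 8 ≤ |r| := by
    rintro j hj r rfl
    rcases (by lia : j ≤ -1 ∨ 1 ≤ j) with h | h
    · have : (j : ℝ) ≤ -1 := by exact_mod_cast h
      rw [le_abs']; left; linarith
    · have : (1 : ℝ) ≤ j := by exact_mod_cast h
      rw [le_abs']; right; linarith
  by_cases hm : m = 0 ∨ m = -1
  -- Here $z=k+\frac{m+1}2-\frac12(m+\frac12)(n+\frac12)$ is an odd multiple of $\frac18$ in each of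
  -- the four cases.
  · by_cases hn : n = 0 ∨ n = -1
    · left
      rcases hm with rfl | rfl <;> rcases hn with rfl | rfl <;> refine ⟨by norm_num, ?_⟩
      · exact eighth (8 * k + 3) (by lia) _ (by push_cast; simp; ring)
      · exact eighth (8 * k + 5) (by lia) _ (by push_cast; simp; ring)
      · exact eighth (8 * k + 1) (by lia) _ (by push_cast; simp; ring)
      · exact eighth (8 * k - 1) (by lia) _ (by push_cast; simp; ring)
    · push Not at hn
      exact Or.inr (Or.inr (half n hn.1 hn.2))
  · push Not at hm
    exact Or.inr (Or.inl (half m hm.1 hm.2))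

theorem arcLength_le_srDist {h : Heis} (hh : h ∈ lattice) :
    ENNReal.ofReal arcLength ≤ srDist 1 (h * ⟨1 / 2, 1 / 2, 1 / 2⟩) := by
  refine le_sInf ?_
  rintro _ ⟨T, g, u₁, u₂, hT, hg, h0, h1, rfl⟩
  exact hg.arcLength_le hT h0 (far_of_mem_lattice hh h1)

/-! ### The arc as an explicit horizontal curve -/

/-- Left translations do not increase the distance. -/
theorem srDist_mul_left_le (k p q : Heis) : srDist (k * p) (k * q) ≤ srDist p q := by
  refine sInf_le_sInf ?_
  rintro _ ⟨T, g, u₁, u₂, hT, hg, h0, h1, rfl⟩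
  exact ⟨T, _, u₁, u₂, hT, hg.mul_left k, by rw [h0], by rw [h1], rfl⟩

theorem srDist_mul_left (k p q : Heis) : srDist (k * p) (k * q) = srDist p q :=
  (srDist_mul_left_le k p q).antisymm (by simpa using srDist_mul_left_le k⁻¹ (k * p) (k * q))

/-- A smooth horizontal curve bounds the distance from above. -/
theorem srDist_le_of_hasDerivAt {x y z u₁ u₂ : ℝ → ℝ} {T C : ℝ} (hT : 0 < T)
    (hx : ∀ t, HasDerivAt x (u₁ t) t) (hy : ∀ t, HasDerivAt y (u₂ t) t)
    (hz : ∀ t, HasDerivAt z ((x t * u₂ t - y t * u₁ t) / 2) t)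
    (hu₁ : Continuous u₁) (hu₂ : Continuous u₂)
    (hC : ∀ t ∈ Set.Icc 0 T, Real.sqrt (u₁ t ^ 2 + u₂ t ^ 2) ≤ C) :
    srDist ⟨x 0, y 0, z 0 + x 0 * y 0 / 2⟩ ⟨x T, y T, z T + x T * y T / 2⟩
      ≤ ENNReal.ofReal (C * T) := by
  have hd : ∀ t, HasDerivAt (fun t => (x t, y t, z t))
      (u₁ t, u₂ t, (x t * u₂ t - y t * u₁ t) / 2) t :=
    fun t => (hx t).prodMk ((hy t).prodMk (hz t))
  have hxc : Continuous x := continuous_iff_continuousAt.2 fun t => (hx t).continuousAt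
  have hyc : Continuous y := continuous_iff_continuousAt.2 fun t => (hy t).continuousAt
  have e : (fun t => (⟨x t, y t, z t + x t * y t / 2⟩ : Heis).xyz) = fun t => (x t, y t, z t) := by
    funext t
    simp [xyz]
  have hg : IsHorizontalOn (fun t => ⟨x t, y t, z t + x t * y t / 2⟩) u₁ u₂ (Set.Icc 0 T) := by
    refine ⟨?_, Filter.Eventually.of_forall fun t => ?_⟩
    · rw [e]
      have h1 : ContDiff ℝ 1 fun t => (x t, y t, z t) := by
        rw [contDiff_one_iff_deriv]
        refine ⟨fun t => (hd t).differentiableAt, ?_⟩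
        rw [funext fun t => (hd t).deriv]
        fun_prop
      exact h1.contDiffOn.exists_lipschitzOnWith (by decide) (convex_Icc _ _) isCompact_Icc
    · rw [e]
      refine (hd t).hasDerivWithinAt.congr_deriv ?_
      simp [X₁, X₂]
      ring
  refine le_trans (sInf_le ?_) (b := srLength u₁ u₂ T) ?_
  · exact ⟨T, fun t => ⟨x t, y t, z t + x t * y t / 2⟩, u₁, u₂, hT, hg, rfl, rfl,
      rfl⟩
  calc srLength u₁ u₂ T ≤ ∫⁻ _ in Set.Icc 0 T, ENNReal.ofReal C :=
        setLIntegral_mono measurable_const fun t ht => ENNReal.ofReal_le_ofReal (hC t ht)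
    _ = ENNReal.ofReal (C * T) := by
        have hC0 : 0 ≤ C := (Real.sqrt_nonneg _).trans (hC 0 ⟨le_rfl, hT.le⟩)
        rw [setLIntegral_const, Real.volume_Icc, sub_zero, ENNReal.ofReal_mul hC0]

/-- The circular arc realizes the distance. -/
theorem srDist_le_arcLength :
    srDist ⟨1, 0, 0⟩ ⟨1 / 2, 1 / 2, 1 / 2⟩ ≤ ENNReal.ofReal arcLength := by
  have h2 : Real.sqrt 2 ^ 2 = 2 := Real.sq_sqrt (by norm_num)
  have hs := sin_arcAngle_ge
  set φ := arcAngle with hφ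
  set κ := 2 * Real.sqrt 2 * Real.sin φ with hκ
  have hκ0 : 0 < κ := by positivity
  -- The chord points from the origin to $(-\frac12,\frac12)$, in direction $3\pi/4$. The heading of
  -- the arc turns from $\varphi$ below this direction to $\varphi$ above it.
  set α := 3 * Real.pi / 4 - φ with hα
  have hlin : ∀ t, HasDerivAt (fun t => α + κ * t) κ t := fun t => by
    simpa using ((hasDerivAt_id t).const_mul κ).const_add α
  have key := srDist_le_of_hasDerivAt (C := 1) arcLength_pos
    (x := fun t => (Real.sin (α + κ * t) - Real.sin α) / κ)
    (y := fun t => -(Real.cos (α + κ * t) - Real.cos α) / κ)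
    (z := fun t => (κ * t - Real.sin (κ * t)) / (2 * κ ^ 2))
    (u₁ := fun t => Real.cos (α + κ * t)) (u₂ := fun t => Real.sin (α + κ * t))
    (fun t => (((hlin t).sin.sub_const _).div_const κ).congr_deriv (by field_simp))
    (fun t => (((hlin t).cos.sub_const _).neg.div_const κ).congr_deriv (by field_simp))
    (fun t => by
      have h1 : HasDerivAt (fun t => κ * t) κ t := by
        simpa using (hasDerivAt_id t).const_mul κ
      refine ((h1.sub h1.sin).div_const (2 * κ ^ 2)).congr_deriv ?_
      have h3 : Real.cos (κ * t) = Real.cos (α + κ * t) * Real.cos α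
          + Real.sin (α + κ * t) * Real.sin α := by
        rw [← Real.cos_sub]; congr 1; ring
      have h4 := Real.sin_sq_add_cos_sq (α + κ * t)
      rw [h3]
      field_simp
      linear_combination -h4)
    (by fun_prop) (by fun_prop) (fun t _ => by simp [Real.cos_sq_add_sin_sq])
  have hκL : κ * arcLength = 2 * φ := by
    rw [hκ]; linear_combination 2 * sqrt_two_mul_sin_mul_arcLength
  have hend : α + 2 * φ = 3 * Real.pi / 4 + φ := by rw [hα]; ring
  have h34 : 3 * Real.pi / 4 = Real.pi - Real.pi / 4 := by ring
  have hc34 : Real.cos (3 * Real.pi / 4) = -(Real.sqrt 2 / 2) := by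
    rw [h34, Real.cos_pi_sub, Real.cos_pi_div_four]
  have hs34 : Real.sin (3 * Real.pi / 4) = Real.sqrt 2 / 2 := by
    rw [h34, Real.sin_pi_sub, Real.sin_pi_div_four]
  have hx : (Real.sin (α + κ * arcLength) - Real.sin α) / κ = -(1 / 2) := by
    rw [hκL, hend, hα, Real.sin_add, Real.sin_sub, hc34, hs34, hκ]
    field_simp
    ring
  have hy : -(Real.cos (α + κ * arcLength) - Real.cos α) / κ = 1 / 2 := by
    rw [hκL, hend, hα, Real.cos_add, Real.cos_sub, hc34, hs34, hκ]
    field_simp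
    ring
  have hz : (κ * arcLength - Real.sin (κ * arcLength)) / (2 * κ ^ 2) = 1 / 8 := by
    have hφe : φ = Real.sin φ ^ 2 + Real.sin φ * Real.cos φ := arcAngle_eq
    rw [hκL, Real.sin_two_mul, hκ, mul_pow, mul_pow, h2, div_eq_iff (by positivity)]
    linear_combination 2 * hφe
  simp only [hx, hy, hz, one_mul] at key
  have hmul := srDist_mul_left ⟨1, 0, 0⟩ 1 ⟨-(1 / 2), 1 / 2, 0⟩
  have e1 : (⟨1, 0, 0⟩ : Heis) * 1 = ⟨1, 0, 0⟩ := mul_one _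
  have e2 : (⟨1, 0, 0⟩ : Heis) * ⟨-(1 / 2), 1 / 2, 0⟩ = ⟨1 / 2, 1 / 2, 1 / 2⟩ := by
    ext <;> norm_num
  rw [e1, e2] at hmul
  rw [hmul]
  convert key using 2
  · ext <;> simp
  · ext <;> norm_num

theorem srDist_eq_arcLength :
    srDist ⟨1, 0, 0⟩ ⟨1 / 2, 1 / 2, 1 / 2⟩ = ENNReal.ofReal arcLength := by
  refine srDist_le_arcLength.antisymm ?_
  -- Since $\tilde g$ is itself in $H$, translation by its inverse moves $\bar g$ to a lattice
  -- translate.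
  have h1 := arcLength_le_srDist (h := ⟨-1, 0, 0⟩) ⟨-1, 0, 0, by ext <;> simp⟩
  rw [← srDist_mul_left ⟨1, 0, 0⟩] at h1
  have e1 : (⟨1, 0, 0⟩ : Heis) * 1 = ⟨1, 0, 0⟩ := mul_one _
  have e2 : (⟨1, 0, 0⟩ : Heis) * (⟨-1, 0, 0⟩ * ⟨1 / 2, 1 / 2, 1 / 2⟩) = ⟨1 / 2, 1 / 2, 1 / 2⟩ := by
    ext <;> norm_num
  rwa [e1, e2] at h1

end Heis

/-! ### Gluing and lifting of horizontal curves -/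

namespace Heis

theorem IsHorizontalOn.mono {g : ℝ → Heis} {u₁ u₂ : ℝ → ℝ} {I J : Set ℝ}
    (hg : IsHorizontalOn g u₁ u₂ I) (hJ : J ⊆ I) : IsHorizontalOn g u₁ u₂ J := by
  obtain ⟨K, hK⟩ := hg.lipschitz
  refine ⟨⟨K, hK.mono hJ⟩, ?_⟩
  filter_upwards [ae_restrict_of_ae_restrict_of_subset hJ hg.velocity] with t ht
  exact ht.mono hJ

/-- For $s\le b\le t$ the distances $|s-b|$ and $|b-t|$ add up to $|s-t|$, so the larger constant
works across $b$. -/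
theorem lipschitzOnWith_Icc_of_Icc {E : Type*} [PseudoMetricSpace E] {f : ℝ → E} {a b c : ℝ}
    {K L : NNReal} (h₁ : LipschitzOnWith K f (Set.Icc a b)) (h₂ : LipschitzOnWith L f (Set.Icc b c)) :
    LipschitzOnWith (max K L) f (Set.Icc a c) := by
  have hK : (K : ℝ) ≤ (max K L : NNReal) := by exact_mod_cast le_max_left K L
  have hL : (L : ℝ) ≤ (max K L : NNReal) := by exact_mod_cast le_max_right K L
  have key : ∀ s ∈ Set.Icc a c, ∀ t ∈ Set.Icc a c, s ≤ t →
      dist (f s) (f t) ≤ (max K L : NNReal) * dist s t := by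
    intro s hs t ht hst
    rcases le_total t b with htb | hbt
    · exact (h₁.dist_le_mul s ⟨hs.1, hst.trans htb⟩ t ⟨ht.1, htb⟩).trans (by gcongr)
    rcases le_total b s with hbs | hsb
    · exact (h₂.dist_le_mul s ⟨hbs, hs.2⟩ t ⟨hbt, ht.2⟩).trans (by gcongr)
    calc dist (f s) (f t) ≤ dist (f s) (f b) + dist (f b) (f t) := dist_triangle _ _ _
      _ ≤ K * dist s b + L * dist b t := add_le_add
          (h₁.dist_le_mul s ⟨hs.1, hsb⟩ b ⟨hs.1.trans hsb, le_rfl⟩)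
          (h₂.dist_le_mul b ⟨le_rfl, hbt.trans ht.2⟩ t ⟨hbt, ht.2⟩)
      _ ≤ (max K L : NNReal) * dist s b + (max K L : NNReal) * dist b t := by gcongr
      _ = (max K L : NNReal) * dist s t := by
          rw [← mul_add, Real.dist_eq, Real.dist_eq, Real.dist_eq, abs_of_nonpos (by linarith),
            abs_of_nonpos (by linarith), abs_of_nonpos (by linarith)]
          ring
  refine LipschitzOnWith.of_dist_le_mul fun s hs t ht => ?_
  rcases le_total s t with h | h
  · exact key s hs t ht h
  · rw [dist_comm (f s), dist_comm s]
    exact key t ht s hs h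

/-- Horizontal curves on adjacent intervals that agree at the common endpoint can be joined. -/
theorem IsHorizontalOn.piecewise {g g' : ℝ → Heis} {u₁ u₂ : ℝ → ℝ} {a b c : ℝ}
    (hg : IsHorizontalOn g u₁ u₂ (Set.Icc a b)) (hg' : IsHorizontalOn g' u₁ u₂ (Set.Icc b c))
    (hb : g b = g' b) :
    IsHorizontalOn (fun t => if t ≤ b then g t else g' t) u₁ u₂ (Set.Icc a c) := by
  set G : ℝ → Heis := fun t => if t ≤ b then g t else g' t with hG
  have e₁ : ∀ t ≤ b, G t = g t := fun t ht => if_pos ht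
  have e₂ : ∀ t, b ≤ t → G t = g' t := by
    intro t ht
    rcases ht.eq_or_lt with rfl | ht
    · rw [e₁ _ le_rfl, hb]
    · exact if_neg (not_le.2 ht)
  obtain ⟨K, hK⟩ := hg.lipschitz
  obtain ⟨L, hL⟩ := hg'.lipschitz
  -- Away from these three times the derivatives within the pieces are two-sided and pass to the
  -- glued curve.
  have hne : ∀ᵐ t : ℝ, t ≠ a ∧ t ≠ b ∧ t ≠ c := by
    filter_upwards [Measure.ae_ne volume a, Measure.ae_ne volume b, Measure.ae_ne volume c]
      with t h1 h2 h3 using ⟨h1, h2, h3⟩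
  refine ⟨⟨max K L, lipschitzOnWith_Icc_of_Icc (b := b) ?_ ?_⟩, ?_⟩
  · intro s hs t ht
    simp only [e₁ s hs.2, e₁ t ht.2]
    exact hK hs ht
  · intro s hs t ht
    simp only [e₂ s hs.1, e₂ t ht.1]
    exact hL hs ht
  · rw [ae_restrict_iff' measurableSet_Icc]
    filter_upwards [(ae_restrict_iff' measurableSet_Icc).1 hg.velocity,
      (ae_restrict_iff' measurableSet_Icc).1 hg'.velocity, hne] with t h1 h2 h3 ht
    have hat : a < t := ht.1.lt_of_ne h3.1.symm
    have htc : t < c := ht.2.lt_of_ne h3.2.2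
    rcases lt_or_gt_of_ne h3.2.1 with htb | hbt
    · have h4 := (h1 ⟨hat.le, htb.le⟩).hasDerivAt (Icc_mem_nhds hat htb)
      rw [← e₁ t htb.le] at h4
      refine (h4.congr_of_eventuallyEq ?_).hasDerivWithinAt
      filter_upwards [eventually_lt_nhds htb] with s hs
      rw [e₁ s hs.le]
    · have h4 := (h2 ⟨hbt.le, htc.le⟩).hasDerivAt (Icc_mem_nhds hbt htc)
      rw [← e₂ t hbt.le] at h4
      refine (h4.congr_of_eventuallyEq ?_).hasDerivWithinAt
      filter_upwards [eventually_gt_nhds hbt] with s hs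
      rw [e₂ s hs.le]

end Heis

namespace Nilmanifold

/-- A horizontal curve in the nil-manifold lifts to a horizontal curve in the Heisenberg group with
a given initial point. -/
theorem IsHorizontal.exists_lift {q : ℝ → Nilmanifold} {u₁ u₂ : ℝ → ℝ} {T : ℝ} (hT : 0 ≤ T)
    (hq : IsHorizontal q u₁ u₂ T) {g₀ : Heis} (h0 : proj g₀ = q 0) :
    ∃ g : ℝ → Heis, Heis.IsHorizontalOn g u₁ u₂ (Set.Icc 0 T) ∧ g 0 = g₀ ∧ proj (g T) = q T := by
  choose! ε hε G hG hGq using hq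
  -- By compactness $[0,T]$ is subdivided so that each $[\tau_n,\tau_{n+1}]$ lies in one chart; the
  -- lift is extended chart by chart.
  obtain ⟨τ, hτ0, hτm, ⟨m, hm⟩, hτ⟩ := exists_monotone_Icc_subset_open_cover_Icc hT
    (c := fun i : Set.Icc 0 T => {t : Set.Icc 0 T | (t : ℝ) ∈ Set.Ioo ((i : ℝ) - ε i) (i + ε i)})
    (fun i => isOpen_Ioo.preimage continuous_subtype_val)
    (fun t _ => Set.mem_iUnion.2 ⟨t, by
      have := hε t t.2
      constructor <;> linarith⟩)
  have hstep : ∀ n, ∃ g : ℝ → Heis, Heis.IsHorizontalOn g u₁ u₂ (Set.Icc 0 (τ n)) ∧ g 0 = g₀ ∧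
      proj (g (τ n)) = q (τ n) := by
    intro n
    induction n with
    | zero =>
      refine ⟨fun _ => g₀, ⟨⟨0, (LipschitzWith.const _).lipschitzOnWith⟩, ?_⟩, rfl, by simp [hτ0, h0]⟩
      simp [hτ0]
    | succ n ih =>
      obtain ⟨g, hg, hg0, hgq⟩ := ih
      obtain ⟨i, hi⟩ := hτ n
      have hle : (τ n : ℝ) ≤ τ (n + 1) := hτm n.le_succ
      have hsub : Set.Icc (τ n : ℝ) (τ (n + 1)) ⊆
          Set.Icc 0 T ∩ Set.Icc ((i : ℝ) - ε i) (i + ε i) := by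
        intro t ht
        have htT : t ∈ Set.Icc 0 T := ⟨(τ n).2.1.trans ht.1, ht.2.trans (τ (n + 1)).2.2⟩
        exact ⟨htT, Set.Ioo_subset_Icc_self (hi (show (⟨t, htT⟩ : Set.Icc 0 T) ∈ _ from ht))⟩
      -- The next local lift starts in the same coset as the current endpoint; left translation by
      -- this $h\in H$ makes them match without changing the controls.
      obtain ⟨h, hh, hgh⟩ := (proj_eq_iff _ _).1
        ((hGq i i.2 _ (hsub ⟨le_rfl, hle⟩)).trans hgq.symm)
      have hj := hg.piecewise (((hG i i.2).mono hsub).mul_left h) hgh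
      refine ⟨_, hj, by simp only [if_pos (τ n).2.1, hg0], ?_⟩
      -- The subdivision is only weakly monotone, so the new interval may be a single point.
      have hend : (if (τ (n + 1) : ℝ) ≤ τ n then g (τ (n + 1)) else h * G i (τ (n + 1)))
          = h * G i (τ (n + 1)) := by
        split_ifs with hc
        · rw [le_antisymm hc hle, hgh]
        · rfl
      rw [hend, ← hGq i i.2 _ (hsub ⟨hle, le_rfl⟩)]
      exact ((proj_eq_iff _ _).2 ⟨h, hh, rfl⟩).symm
  obtain ⟨g, hg, hg0, hgT⟩ := hstep m
  rw [hm m le_rfl] at hg hgT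
  exact ⟨g, hg, hg0, hgT⟩

theorem arcLength_le_srDist :
    ENNReal.ofReal arcLength ≤ srDist (proj 1) (proj ⟨1 / 2, 1 / 2, 1 / 2⟩) := by
  refine le_sInf ?_
  rintro _ ⟨T, q, u₁, u₂, hT, hq, h0, h1, rfl⟩
  obtain ⟨g, hg, hg0, hgT⟩ := hq.exists_lift hT.le h0.symm
  obtain ⟨h, hh, hgh⟩ := (proj_eq_iff _ _).1 (hgT.trans h1).symm
  exact hg.arcLength_le hT hg0 (Heis.far_of_mem_lattice hh hgh)

/-- The projection does not increase distances. -/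
theorem srDist_proj_le (p q : Heis) : srDist (proj p) (proj q) ≤ Heis.srDist p q := by
  refine sInf_le_sInf ?_
  rintro _ ⟨T, g, u₁, u₂, hT, hg, h0, h1, rfl⟩
  refine ⟨T, fun t => proj (g t), u₁, u₂, hT, fun t₀ _ => ⟨1, one_pos, g, ?_, fun t _ => rfl⟩,
    congrArg proj h0, congrArg proj h1, rfl⟩
  exact hg.mono Set.inter_subset_left

/-! ### Finiteness of the covering radius -/

theorem exists_unit_representative (q : Nilmanifold) :
    ∃ g : Heis, proj g = q ∧ g.a ∈ Set.Icc 0 1 ∧ g.b ∈ Set.Icc 0 1 ∧ g.c ∈ Set.Icc 0 1 := by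
  obtain ⟨g, rfl⟩ := Quotient.exists_rep q
  set m : ℤ := -⌊g.a⌋
  set n : ℤ := -⌊g.b⌋
  -- Left multiplication shears $c$ by $mb$, so the third entry is rounded after $m$ has been fixed.
  refine ⟨⟨m, n, (-⌊g.c + m * g.b⌋ : ℤ)⟩ * g, ((proj_eq_iff _ _).2 ⟨_, ⟨m, n, _, rfl⟩, rfl⟩).symm,
    ?_, ?_, ?_⟩
  · have h1 := Int.floor_le g.a
    have h2 := Int.lt_floor_add_one g.a
    simp only [Heis.mul_a, m]
    push_cast
    constructor <;> linarith
  · have h1 := Int.floor_le g.b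
    have h2 := Int.lt_floor_add_one g.b
    simp only [Heis.mul_b, n]
    push_cast
    constructor <;> linarith
  · have h1 := Int.floor_le (g.c + m * g.b)
    have h2 := Int.lt_floor_add_one (g.c + m * g.b)
    simp only [Heis.mul_c]
    push_cast
    constructor <;> linarith

end Nilmanifold

namespace Heis

/-- A uniform bound for the distance to the points of the unit cube. -/
theorem srDist_one_le {g : Heis} (ha : g.a ∈ Set.Icc 0 1) (hb : g.b ∈ Set.Icc 0 1)
    (hc : g.c ∈ Set.Icc 0 1) : srDist 1 g ≤ ENNReal.ofReal 1000 := by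
  obtain ⟨a, b, c⟩ := g
  simp only at ha hb hc
  -- The segment to $(a,b)$ is perturbed by $t-t^2$ in $x$ and by $B(t-3t^2+2t^3)$ in $y$, both
  -- vanishing at the ends. The swept area is $b/6-B/30$, and $B$ is solved from this; the radius
  -- $1000$ is deliberately crude.
  set B := 30 * (b / 6 - (c - a * b / 2)) with hB
  have hab0 : 0 ≤ a * b := mul_nonneg ha.1 hb.1
  have hab1 : a * b ≤ 1 := mul_le_one₀ ha.2 hb.1 hb.2
  have hB1 : -30 ≤ B := by rw [hB]; linarith [hb.1, hc.2]
  have hB2 : B ≤ 20 := by rw [hB]; linarith [hb.2, hc.1]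
  have d1 (t : ℝ) : HasDerivAt (fun t : ℝ => t) 1 t := hasDerivAt_id t
  have d (n : ℕ) (t : ℝ) : HasDerivAt (fun t : ℝ => t ^ n) (n * t ^ (n - 1)) t := hasDerivAt_pow n t
  have key := srDist_le_of_hasDerivAt (T := 1) (C := 1000) one_pos
    (x := fun t => a * t + (t - t ^ 2)) (y := fun t => b * t + B * (t - 3 * t ^ 2 + 2 * t ^ 3))
    (z := fun t => (a * B * (t ^ 4 - t ^ 3) + b / 3 * t ^ 3
      + B * (t ^ 4 - 2 / 3 * t ^ 3 - 2 / 5 * t ^ 5)) / 2)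
    (u₁ := fun t => a + (1 - 2 * t)) (u₂ := fun t => b + B * (1 - 6 * t + 6 * t ^ 2))
    (fun t => (((d1 t).const_mul a).add ((d1 t).sub (d 2 t))).congr_deriv (by push_cast; ring))
    (fun t => (((d1 t).const_mul b).add ((((d1 t).sub ((d 2 t).const_mul 3)).add
      ((d 3 t).const_mul 2)).const_mul B)).congr_deriv (by push_cast; ring))
    (fun t => ((((((d 4 t).sub (d 3 t)).const_mul (a * B)).add ((d 3 t).const_mul (b / 3))).add
      ((((d 4 t).sub ((d 3 t).const_mul (2 / 3))).sub
        ((d 5 t).const_mul (2 / 5))).const_mul B)).div_const 2).congr_deriv (by push_cast; ring))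
    (by fun_prop) (by fun_prop) (fun t ht => by
      rw [Real.sqrt_le_left (by norm_num)]
      have h1 : |a + (1 - 2 * t)| ≤ 2 := by
        rw [abs_le]; constructor <;> linarith [ha.1, ha.2, ht.1, ht.2]
      have h2 : |1 - 6 * t + 6 * t ^ 2| ≤ 1 := by
        rw [abs_le]; constructor <;> nlinarith [ht.1, ht.2, sq_nonneg (t - 1 / 2)]
      have h3 : |b + B * (1 - 6 * t + 6 * t ^ 2)| ≤ 31 := by
        have h4 : |B| ≤ 30 := by rw [abs_le]; constructor <;> linarith
        calc |b + B * (1 - 6 * t + 6 * t ^ 2)| ≤ |b| + |B| * |1 - 6 * t + 6 * t ^ 2| := by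
              rw [← abs_mul]; exact abs_add_le _ _
          _ ≤ 1 + 30 * 1 := by
              gcongr
              rw [abs_le]; constructor <;> linarith [hb.1, hb.2]
          _ = 31 := by norm_num
      rw [← sq_abs (a + _), ← sq_abs (b + _)]
      calc _ ≤ (2 : ℝ) ^ 2 + 31 ^ 2 := by gcongr
        _ ≤ 1000 ^ 2 := by norm_num)
  convert key using 2
  · ext <;> simp
  · ext
    · ring
    · ring
    · simp only
      rw [hB]
      ring
  · norm_num

end Heis

/-! ### Conclusion -/

theorem mainTheorem9 :
    Heis.srDist ⟨1, 0, 0⟩ ⟨1 / 2, 1 / 2, 1 / 2⟩ ≤ ENNReal.ofReal Nilmanifold.coveringRadius ∧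
    (∀ t : ℝ, 0 ≤ t →
      ENNReal.ofReal t < Heis.srDist ⟨1, 0, 0⟩ ⟨1 / 2, 1 / 2, 1 / 2⟩ →
      (⟨1 / 2, 1 / 2, 1 / 2⟩ : Heis) ∉ (Heis.lattice : Set Heis) * Heis.srBall t) ∧
    Heis.srDist ⟨1, 0, 0⟩ ⟨1 / 2, 1 / 2, 1 / 2⟩ < 1 ∧
    ENNReal.ofReal 0.91 < Heis.srDist ⟨1, 0, 0⟩ ⟨1 / 2, 1 / 2, 1 / 2⟩ ∧
    Heis.srDist ⟨1, 0, 0⟩ ⟨1 / 2, 1 / 2, 1 / 2⟩ < ENNReal.ofReal 0.92 := by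
  rw [Heis.srDist_eq_arcLength]
  refine ⟨?_, ?_, ?_, ?_, ?_⟩
  -- The infimum of an empty set of reals is $0$ by default, so a covering radius must be exhibited
  -- before the lower bound can be used.
  · refine ENNReal.ofReal_le_ofReal (le_csInf ⟨1000, by norm_num, ?_⟩ ?_)
    · refine Set.eq_univ_of_forall fun q => ?_
      obtain ⟨g, rfl, ha, hb, hc⟩ := Nilmanifold.exists_unit_representative q
      exact (Nilmanifold.srDist_proj_le 1 g).trans (Heis.srDist_one_le ha hb hc)
    · rintro t ⟨ht, hball⟩
      have h : Nilmanifold.proj ⟨1 / 2, 1 / 2, 1 / 2⟩ ∈ Nilmanifold.srBall t := by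
        rw [hball]; trivial
      exact (ENNReal.ofReal_le_ofReal_iff ht.le).1 (Nilmanifold.arcLength_le_srDist.trans h)
  · rintro t - ht ⟨h, hh, g, hg, hgh⟩
    -- If $\bar g=hg$ with $g\in B_t$, then $g=h^{-1}\bar g$ is a lattice translate too close to the
    -- identity.
    refine absurd (ht.trans_le (Heis.arcLength_le_srDist (inv_mem hh))) (not_lt.2 ?_)
    have e : h⁻¹ * ⟨1 / 2, 1 / 2, 1 / 2⟩ = g := by
      rw [← hgh]; exact inv_mul_cancel_left h g
    rw [e]
    exact hg
  · rw [← ENNReal.ofReal_one, ENNReal.ofReal_lt_ofReal_iff one_pos]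
    linarith [arcLength_lt]
  · exact (ENNReal.ofReal_lt_ofReal_iff arcLength_pos).2 arcLength_gt
  · exact (ENNReal.ofReal_lt_ofReal_iff (by norm_num)).2 arcLength_lt

end
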